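/- **Theorem 1.** Let $A\in\mathbb{R}^{n\times n}$, $B\in\mathbb{R}^{n\times p}$, $Q\in\mathbb{R}^{n\times q}$, let $w\in\mathbb{R}^q$ be a constant disturbance, and let $P\succ 0$ be a symmetric positive definite matrix with $A^TP+PA\preceq -I$ (so that $A$ is invertible). Put $H:=-A^{-1}B$, $R:=-A^{-1}Q$ and $\widetilde H^T:=[\,H^T\ \ I_p\,]$. Let $\Phi:\mathbb{R}^n\times\mathbb{R}^p\to\mathbb{R}$ be a differentiable cost function such that $(x,u)\mapsto\widetilde H^T\nabla\Phi(x,u)$ is continuous, such that the reduced cost $\tilde\Phi^w(u):=\Phi(Hu+Rw,u)$ has compact sublevel sets $\{u\mid\tilde\Phi^w(u)\le c\}$ for all $c\in\mathbb{R}$, and such that for some $\ell>0$ $$\bigl\|\widetilde H^T\bigl(\nabla\Phi(x,u)-\nabla\Phi(x',u)\bigr)\bigr\|\le \ell\,\|x-x'\|\qquad\text{for all }x,x'\in\mathbb{R}^n,\ u\in\mathbb{R}^p .$$ Consider the optimization problem $$\text{minimize }\ \Phi(x,u)\quad\text{subject to}\quad x=Hu+Rw, \tag{1}$$ whose critical points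 are the feasible points $(x,u)$ with $\nabla\Phi(x,u)\in\operatorname{im}\begin{bmatrix} I_n\\ -H^T\end{bmatrix}$, and the closed-loop system $$\dot x=Ax+Bu+Qw,\qquad \dot u=-\epsilon\,\widetilde H^T\nabla\Phi(x,u). \tag{2}$$ If $$0<\epsilon<\epsilon^\star:=\frac{1}{2\,\ell\,\|PH\|}$$ (with the spectral norm, and $\epsilon^\star=+\infty$ if $PH=0$), then (2) has a solution on $[0,\infty)$ from every initial value, every solution of (2) on an interval $[0,T)$ extends to a solution on $[0,\infty)$, and for every solution on $[0,\infty)$ the distance of $(x(t),u(t))$ to the set of critical points of (1) tends to $0$ as $t\to\infty$. Moreover, every asymptotically stable equilibrium of (2) is a strict local minimizer of (1). -/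

import Mathlib

open Filter Topology Set
open scoped Matrix Matrix.Norms.L2Operator

noncomputable section

namespace FeedbackOpt

/-! The plant is `ẋ = A x + B u + Q w`, with `x ∈ ℝⁿ`, `u ∈ ℝᵖ` and a constant `w ∈ ℝ^q`.
The cost `Φ` is a function of the pair `(x, u)`. The norm of a matrix is the operator norm
induced by the Euclidean norms. -/

variable {n p q : ℕ}

/-- The product of a matrix and a vector of a Euclidean space. -/
def act {k m : ℕ} (M : Matrix (Fin k) (Fin m) ℝ) (v : EuclideanSpace ℝ (Fin m)) :
    EuclideanSpace ℝ (Fin k) :=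
  WithLp.toLp 2 (M *ᵥ v.ofLp)

/-- The steady-state gain `-A⁻¹ M`. It is `H` for `M = B` and `R` for `M = Q`. -/
def gain {m : ℕ} (A : Matrix (Fin n) (Fin n) ℝ) (M : Matrix (Fin n) (Fin m) ℝ) :
    Matrix (Fin n) (Fin m) ℝ :=
  -(A⁻¹ * M)

/-- The steady state `H u + R w`. -/
def steadyState (A : Matrix (Fin n) (Fin n) ℝ) (B : Matrix (Fin n) (Fin p) ℝ)
    (Q : Matrix (Fin n) (Fin q) ℝ) (w : EuclideanSpace ℝ (Fin q))
    (u : EuclideanSpace ℝ (Fin p)) : EuclideanSpace ℝ (Fin n) :=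
  act (gain A B) u + act (gain A Q) w

/-- The feasible set `{(x, u) | x = H u + R w}` of the steady-state optimization problem. -/
def feasibleSet (A : Matrix (Fin n) (Fin n) ℝ) (B : Matrix (Fin n) (Fin p) ℝ)
    (Q : Matrix (Fin n) (Fin q) ℝ) (w : EuclideanSpace ℝ (Fin q)) :
    Set (EuclideanSpace ℝ (Fin n) × EuclideanSpace ℝ (Fin p)) :=
  {z | z.1 = steadyState A B Q w z.2}

/-- The reduced cost `u ↦ Φ(H u + R w, u)`. -/
def reducedCost (A : Matrix (Fin n) (Fin n) ℝ) (B : Matrix (Fin n) (Fin p) ℝ)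
    (Q : Matrix (Fin n) (Fin q) ℝ) (w : EuclideanSpace ℝ (Fin q))
    (Φ : EuclideanSpace ℝ (Fin n) × EuclideanSpace ℝ (Fin p) → ℝ)
    (u : EuclideanSpace ℝ (Fin p)) : ℝ :=
  Φ (steadyState A B Q w u, u)

/-- The block `∇ₓ Φ` of the gradient of `Φ` at the point `z = (x, u)`. -/
def gradX (Φ : EuclideanSpace ℝ (Fin n) × EuclideanSpace ℝ (Fin p) → ℝ)
    (z : EuclideanSpace ℝ (Fin n) × EuclideanSpace ℝ (Fin p)) : EuclideanSpace ℝ (Fin n) :=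
  gradient (fun x => Φ (x, z.2)) z.1

/-- The block `∇ᵤ Φ` of the gradient of `Φ` at the point `z = (x, u)`. -/
def gradU (Φ : EuclideanSpace ℝ (Fin n) × EuclideanSpace ℝ (Fin p) → ℝ)
    (z : EuclideanSpace ℝ (Fin n) × EuclideanSpace ℝ (Fin p)) : EuclideanSpace ℝ (Fin p) :=
  gradient (fun u => Φ (z.1, u)) z.2

/-- The vector `H̃ᵀ ∇Φ = Hᵀ ∇ₓ Φ + ∇ᵤ Φ` at the point `z = (x, u)`, where `H̃ᵀ = [Hᵀ  I]`. -/
def feedbackGrad (A : Matrix (Fin n) (Fin n) ℝ) (B : Matrix (Fin n) (Fin p) ℝ)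
    (Φ : EuclideanSpace ℝ (Fin n) × EuclideanSpace ℝ (Fin p) → ℝ)
    (z : EuclideanSpace ℝ (Fin n) × EuclideanSpace ℝ (Fin p)) : EuclideanSpace ℝ (Fin p) :=
  act (gain A B)ᵀ (gradX Φ z) + gradU Φ z

/-- The closed-loop vector field `(A x + B u + Q w, -ε H̃ᵀ ∇Φ(x, u))`. -/
def closedLoop (A : Matrix (Fin n) (Fin n) ℝ) (B : Matrix (Fin n) (Fin p) ℝ)
    (Q : Matrix (Fin n) (Fin q) ℝ) (w : EuclideanSpace ℝ (Fin q)) (ε : ℝ)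
    (Φ : EuclideanSpace ℝ (Fin n) × EuclideanSpace ℝ (Fin p) → ℝ)
    (z : EuclideanSpace ℝ (Fin n) × EuclideanSpace ℝ (Fin p)) :
    EuclideanSpace ℝ (Fin n) × EuclideanSpace ℝ (Fin p) :=
  (act A z.1 + act B z.2 + act Q w, -(ε • feedbackGrad A B Φ z))

/-- The critical points of the steady-state optimization problem: feasible points where `∇Φ` lies
in the image of the block matrix with rows `I` and `-Hᵀ` (first-order optimality condition). -/
def criticalSet (A : Matrix (Fin n) (Fin n) ℝ) (B : Matrix (Fin n) (Fin p) ℝ)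
    (Q : Matrix (Fin n) (Fin q) ℝ) (w : EuclideanSpace ℝ (Fin q))
    (Φ : EuclideanSpace ℝ (Fin n) × EuclideanSpace ℝ (Fin p) → ℝ) :
    Set (EuclideanSpace ℝ (Fin n) × EuclideanSpace ℝ (Fin p)) :=
  {z | z ∈ feasibleSet A B Q w ∧
    ∃ v : EuclideanSpace ℝ (Fin n), gradX Φ z = v ∧ gradU Φ z = -act (gain A B)ᵀ v}

/-- `z` is a strict local minimizer of `Φ` over the set `S`. -/
def IsStrictLocalMinimizerOn {E : Type*} [TopologicalSpace E] (Φ : E → ℝ) (S : Set E) (z : E) :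
    Prop :=
  z ∈ S ∧ ∀ᶠ y in 𝓝[S \ {z}] z, Φ z < Φ y

section Dynamics

variable {E : Type*} [NormedAddCommGroup E] [NormedSpace ℝ E]

/-- `z` solves `ż = F(z)` on the set `J` of times (with one-sided derivatives at end points). -/
def IsSolutionOn (F : E → E) (J : Set ℝ) (z : ℝ → E) : Prop :=
  IsIntegralCurveOn z (fun _ => F) J

/-- `zs` is an asymptotically stable equilibrium of `ż = F(z)`: an equilibrium that is stable in
the sense of Lyapunov (for all solutions, whatever their time of existence) and locally
attractive. -/
def IsAsymptoticallyStable (F : E → E) (zs : E) : Prop :=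
  F zs = 0 ∧
  (∀ r > 0, ∃ d > 0, ∀ (T : ℝ) (z : ℝ → E), 0 < T → IsSolutionOn F (Ico 0 T) z →
    dist (z 0) zs < d → ∀ t ∈ Ico 0 T, dist (z t) zs < r) ∧
  (∃ d > 0, ∀ z : ℝ → E, IsSolutionOn F (Ici 0) z →
    dist (z 0) zs < d → Tendsto z atTop (𝓝 zs))

end Dynamics

end FeedbackOpt

end

open FeedbackOpt

open FeedbackOpt

/-!
Write `y = x - (H u + R w)` for the deviation of the state from the steady state, `g` for the
feedback gradient `H̃ᵀ ∇Φ` and `φ` for the reduced cost. Since `A H = -B` and `A R = -Q`, the closed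
loop reads `ẏ = A y + ε H g(x, u)`, `u̇ = -ε g(x, u)`, while `∇φ(u) = g(H u + R w, u)`. The energy
`V = a φ(u) + b ⟪y, P y⟫` therefore satisfies
`V̇ ≤ -(a ε ‖g‖² - ε (a ℓ + 2 b ‖P H‖) ‖g‖ ‖y‖ + b ‖y‖²)` (`fderiv_energy_closedLoop_le`).
The bound on `ε` is exactly the condition under which some weights `a, b > 0` make this quadratic
form definite (`exists_weights`). Then `V̇ ≤ -c ‖F‖²`, where `F` is the closed-loop field
(`exists_fderiv_energy_le`), and `V` has compact sublevel sets (`isCompact_sublevel_energy`).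

Everything else holds for any continuous field `F` with such a function `V`. As `F` need not be
Lipschitz, solutions come from Peano's theorem (`exists_solution_of_bounded`), and uniqueness is
never used. Sublevel sets of `V` trap solutions, which gives existence for all times and extension
(`exists_solution_of_nonincreasing`, `exists_extension_of_nonincreasing`). The decay rate gives
convergence to the zeros of `F` (`tendsto_infEDist_zeros`), which are the critical points
(`zeros_closedLoop`), and makes every asymptotically stable equilibrium a strict local minimizer of
`V` (`strictLocalMin_of_isAsymptoticallyStable`). On the feasible set `V = a Φ`.
-/

/-! ### Peano's theorem for bounded fields -/

section Peano

variable {E : Type*} [NormedAddCommGroup E] [NormedSpace ℝ E]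

/-- The explicit Euler scheme with step `h` for `ż = G(z)`, started at `z₀`. -/
noncomputable def eulerSeq (G : E → E) (z₀ : E) (h : ℝ) : ℕ → E
  | 0 => z₀
  | j + 1 => eulerSeq G z₀ h j + h • G (eulerSeq G z₀ h j)

/-- If the field is `η`-close to `v` along a stretch of the Euler scheme, then so is the mean
velocity of that stretch. With `v = 0` this is the Lipschitz bound in time. -/
theorem norm_eulerSeq_sub_le {G : E → E} {z₀ : E} {h η : ℝ} (hh : 0 ≤ h) {v : E} {i j : ℕ}
    (hij : i ≤ j) (hG : ∀ l, i ≤ l → l < j → ‖G (eulerSeq G z₀ h l) - v‖ ≤ η) :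
    ‖eulerSeq G z₀ h j - eulerSeq G z₀ h i - (((j : ℝ) - i) * h) • v‖ ≤ ((j : ℝ) - i) * h * η := by
  induction j, hij using Nat.le_induction with
  | base => simp
  | succ j hij ih =>
    have h1 := ih fun l hl hl' => hG l hl (by omega)
    have h2 := hG j hij (by omega)
    have h3 : eulerSeq G z₀ h (j + 1) - eulerSeq G z₀ h i - ((((j + 1 : ℕ) : ℝ) - i) * h) • v
        = (eulerSeq G z₀ h j - eulerSeq G z₀ h i - (((j : ℝ) - i) * h) • v)
          + h • (G (eulerSeq G z₀ h j) - v) := by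
      simp only [eulerSeq, Nat.cast_add, Nat.cast_one]
      module
    rw [h3]
    refine (norm_add_le _ _).trans ?_
    rw [norm_smul, Real.norm_of_nonneg hh]
    have h4 := mul_le_mul_of_nonneg_left h2 hh
    push_cast
    linarith

theorem norm_eulerSeq_sub_le_abs {G : E → E} {z₀ : E} {h M : ℝ} (hh : 0 ≤ h)
    (hM : ∀ z, ‖G z‖ ≤ M) (i j : ℕ) :
    ‖eulerSeq G z₀ h j - eulerSeq G z₀ h i‖ ≤ |(j : ℝ) - i| * h * M := by
  rcases le_total i j with hij | hij
  · have := norm_eulerSeq_sub_le (z₀ := z₀) hh (v := 0) hij (η := M)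
      fun l _ _ => by simpa using hM _
    rwa [smul_zero, sub_zero, ← abs_of_nonneg (sub_nonneg.2 (Nat.cast_le (α := ℝ).2 hij))] at this
  · have := norm_eulerSeq_sub_le (z₀ := z₀) hh (v := 0) hij (η := M)
      fun l _ _ => by simpa using hM _
    rwa [smul_zero, sub_zero, ← abs_of_nonneg (sub_nonneg.2 (Nat.cast_le (α := ℝ).2 hij)),
      norm_sub_rev, abs_sub_comm] at this

/-- Peano's existence theorem for a bounded continuous field. The Euler scheme of step `1 / (k + 1)`
is read as a step function of time, and the solution is its pointwise limit along an ultrafilter.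
Since the speeds are bounded, the approximants are close to each other near a given time, so that
the local velocity estimate passes to the limit without any uniform convergence. -/
theorem exists_solution_of_bounded [ProperSpace E] {G : E → E} (hG : Continuous G) {M : ℝ}
    (hM : ∀ z, ‖G z‖ ≤ M) (z₀ : E) : ∃ z, IsSolutionOn G (Ici 0) z ∧ z 0 = z₀ := by
  have hM0 : 0 ≤ M := (norm_nonneg _).trans (hM z₀)
  let h : ℕ → ℝ := fun k => 1 / ((k : ℝ) + 1)
  let N : ℕ → ℝ → ℕ := fun k t => ⌊t * ((k : ℝ) + 1)⌋₊
  let x : ℕ → ℕ → E := fun k => eulerSeq G z₀ (h k)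
  have hpos : ∀ k : ℕ, 0 < (k : ℝ) + 1 := fun k => by positivity
  have hh : ∀ k, 0 ≤ h k := fun k => by positivity
  have hmulh : ∀ k : ℕ, ((k : ℝ) + 1) * h k = 1 := fun k => mul_one_div_cancel (hpos k).ne'
  have hlow : ∀ k t, t < N k t * h k + h k := fun k t => by
    have h1 := mul_lt_mul_of_pos_right (Nat.lt_floor_add_one (t * ((k : ℝ) + 1)))
      (one_div_pos.2 (hpos k))
    have h2 := hmulh k
    calc t = t * (((k : ℝ) + 1) * h k) := by rw [h2, mul_one]
      _ < _ := by simpa only [N, h, mul_assoc, add_mul, one_mul] using h1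
  have hup : ∀ k t, 0 ≤ t → N k t * h k ≤ t := fun k t ht => by
    have h1 := mul_le_mul_of_nonneg_right
      (Nat.floor_le (mul_nonneg ht (hpos k).le)) (hh k)
    rwa [mul_assoc, hmulh, mul_one] at h1
  have hNh : ∀ k t, N k t * h k ≤ |t| := fun k t => by
    rcases le_total 0 t with ht | ht
    · exact (hup k t ht).trans (le_abs_self t)
    · have : N k t = 0 := Nat.floor_of_nonpos (mul_nonpos_of_nonpos_of_nonneg ht (hpos k).le)
      simp [this]
  let U : Ultrafilter ℕ := hyperfilter ℕ
  have hU : (U : Filter ℕ) ≤ atTop := Nat.hyperfilter_le_atTop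
  have hh0 : Tendsto h U (𝓝 0) := tendsto_one_div_add_atTop_nhds_zero_nat.mono_left hU
  have hlim : ∀ t : ℝ, ∃ y, Tendsto (fun k => x k (N k t)) U (𝓝 y) := fun t => by
    have hc : IsCompact (Metric.closedBall z₀ (|t| * M)) := isCompact_closedBall _ _
    obtain ⟨y, -, hy⟩ := hc.ultrafilter_le_nhds' (U.map fun k => x k (N k t)) <| by
      refine Ultrafilter.mem_map.2 (univ_mem' fun k => ?_)
      have h1 := norm_eulerSeq_sub_le_abs (z₀ := z₀) (hh k) hM 0 (N k t)
      rw [Nat.cast_zero, sub_zero, abs_of_nonneg (Nat.cast_nonneg _)] at h1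
      rw [mem_preimage, mem_closedBall_iff_norm]
      exact h1.trans (mul_le_mul_of_nonneg_right (hNh k t) hM0)
    exact ⟨y, hy⟩
  choose z hz using hlim
  have hNlim : ∀ t, 0 ≤ t → Tendsto (fun k => N k t * h k) U (𝓝 t) := fun t ht =>
    tendsto_of_tendsto_of_tendsto_of_le_of_le (by simpa using tendsto_const_nhds.sub hh0)
      tendsto_const_nhds (fun k => by have := hlow k t; simp only; linarith)
      (fun k => hup k t ht)
  -- the mean velocity of the limit near the time `c` is close to `G (z c)`
  have key : ∀ c, 0 ≤ c → ∀ η > 0, ∃ τ > 0, ∀ a b, 0 ≤ a → a ≤ b → |a - c| < τ → |b - c| < τ →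
      ‖z b - z a - (b - a) • G (z c)‖ ≤ (b - a) * η := by
    intro c hc η hη
    obtain ⟨δ, hδ, hδG⟩ := Metric.continuousAt_iff.1 (hG.continuousAt (x := z c)) η hη
    refine ⟨δ / (4 * (M + 1)), by positivity, fun a b ha hab hac hbc => ?_⟩
    have hb := ha.trans hab
    have hτ : δ / (4 * (M + 1)) * M ≤ δ / 4 := by
      rw [div_mul_eq_mul_div, div_le_div_iff₀ (by positivity) (by positivity)]
      nlinarith
    have hclose : ∀ᶠ k in (U : Filter ℕ), dist (x k (N k c)) (z c) < δ / 2 :=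
      Metric.tendsto_nhds.1 (hz c) _ (by positivity)
    have hsmall : ∀ᶠ k in (U : Filter ℕ), h k * M < δ / 4 :=
      ((hh0.mul_const M).eventually_lt_const (by rw [zero_mul]; positivity))
    have hlimL : Tendsto (fun k => ‖x k (N k b) - x k (N k a)
        - (N k b * h k - N k a * h k) • G (z c)‖) U (𝓝 ‖z b - z a - (b - a) • G (z c)‖) :=
      (((hz b).sub (hz a)).sub (((hNlim b hb).sub (hNlim a ha)).smul_const _)).norm
    have hlimR := ((hNlim b hb).sub (hNlim a ha)).mul_const η
    refine le_of_tendsto_of_tendsto hlimL hlimR ?_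
    filter_upwards [hclose, hsmall] with k hk1 hk2
    have hN : N k a ≤ N k b := Nat.floor_le_floor (mul_le_mul_of_nonneg_right hab (hpos k).le)
    rw [← sub_mul]
    refine norm_eulerSeq_sub_le (hh k) hN fun l hl1 hl2 => ?_
    rw [← dist_eq_norm]
    refine (hδG ?_).le
    have h1 := norm_eulerSeq_sub_le_abs (z₀ := z₀) (hh k) hM (N k c) l
    have h2 : |(l : ℝ) - N k c| * h k ≤ δ / (4 * (M + 1)) + h k := by
      rw [← abs_of_nonneg (hh k), ← abs_mul, abs_of_nonneg (hh k), sub_mul, abs_le]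
      have e1 := mul_le_mul_of_nonneg_right (Nat.cast_le (α := ℝ).2 hl1) (hh k)
      have e2 := mul_le_mul_of_nonneg_right (Nat.cast_le (α := ℝ).2 hl2.le) (hh k)
      have e3 := hlow k a
      have e4 := hup k b hb
      have e5 := hlow k c
      have e6 := hup k c hc
      rw [abs_lt] at hac hbc
      constructor <;> linarith
    have h3 := mul_le_mul_of_nonneg_right h2 hM0
    calc dist (x k l) (z c) ≤ dist (x k l) (x k (N k c)) + dist (x k (N k c)) (z c) :=
          dist_triangle _ _ _
      _ < δ := by rw [dist_eq_norm (x k l)]; linarith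
  refine ⟨z, fun c hc => ?_, ?_⟩
  · rw [hasDerivWithinAt_iff_isLittleO, Asymptotics.isLittleO_iff]
    intro η hη
    obtain ⟨τ, hτ, hkey⟩ := key c hc η hη
    filter_upwards [self_mem_nhdsWithin,
      mem_nhdsWithin_of_mem_nhds (Metric.ball_mem_nhds c hτ)] with t ht htc
    rw [Metric.mem_ball, Real.dist_eq] at htc
    rcases le_total c t with hct | hct
    · have := hkey c t hc hct (by simpa using hτ) htc
      rw [Real.norm_of_nonneg (sub_nonneg.2 hct)]
      linarith
    · have := hkey t c ht hct htc (by simpa using hτ)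
      rw [Real.norm_of_nonpos (sub_nonpos.2 hct), ← norm_neg]
      rw [show -(z t - z c - (t - c) • G (z c)) = z c - z t - (c - t) • G (z c) by module]
      linarith
  · refine tendsto_nhds_unique (hz 0) ?_
    simp [N, x, eulerSeq]

end Peano

/-! ### Continuous fields with a Lyapunov function of compact sublevel sets -/

section Lyapunov

variable {E : Type*} [NormedAddCommGroup E] [NormedSpace ℝ E] {F : E → E} {V : E → ℝ} {c : ℝ}

theorem hasDerivWithinAt_comp_solution (hV : Differentiable ℝ V) {J : Set ℝ} {z : ℝ → E}
    (hz : IsSolutionOn F J z) {t : ℝ} (ht : t ∈ J) :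
    HasDerivWithinAt (V ∘ z) (fderiv ℝ V (z t) (F (z t))) J t :=
  (hV (z t)).hasFDerivAt.comp_hasDerivWithinAt t (hz t ht)

theorem antitoneOn_comp_solution (hV : Differentiable ℝ V) (hdec : ∀ z, fderiv ℝ V z (F z) ≤ 0)
    {J : Set ℝ} (hJ : Convex ℝ J) {z : ℝ → E} (hz : IsSolutionOn F J z) :
    AntitoneOn (V ∘ z) J :=
  antitoneOn_of_hasDerivWithinAt_nonpos hJ
    (fun _ ht => (hasDerivWithinAt_comp_solution hV hz ht).continuousWithinAt)
    (fun _ ht => (hasDerivWithinAt_comp_solution hV hz (interior_subset ht)).mono interior_subset)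
    fun _ _ => hdec _

theorem norm_solution_sub_le {K : Set E} {M : ℝ} (hM : ∀ z ∈ K, ‖F z‖ ≤ M) {J : Set ℝ}
    (hJ : Convex ℝ J) {z : ℝ → E} (hz : IsSolutionOn F J z) (hzK : ∀ t ∈ J, z t ∈ K) {s t : ℝ}
    (hs : s ∈ J) (ht : t ∈ J) : ‖z t - z s‖ ≤ M * |t - s| :=
  hJ.norm_image_sub_le_of_norm_hasDerivWithin_le hz (fun r hr => hM _ (hzK r hr)) hs ht

/-- The speed of a solution inside a compact set is bounded, so that the solution is Lipschitz. -/
theorem exists_tendsto_solution (hF : Continuous F) {K : Set E} (hK : IsCompact K) {T : ℝ}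
    (hT : 0 < T) {z : ℝ → E} (hz : IsSolutionOn F (Ico 0 T) z) (hzK : ∀ t ∈ Ico 0 T, z t ∈ K) :
    ∃ y, Tendsto z (𝓝[<] T) (𝓝 y) := by
  obtain ⟨M, hM⟩ := hK.exists_bound_of_continuousOn hF.continuousOn
  have hlip : LipschitzOnWith (Real.toNNReal M) z (Ico 0 T) :=
    LipschitzOnWith.of_dist_le' fun s hs t ht => by
      simpa only [dist_eq_norm, Real.norm_eq_abs] using
        norm_solution_sub_le hM (convex_Ico 0 T) hz hzK ht hs
  have hmem : Ico 0 T ∈ 𝓝[<] T := Ico_mem_nhdsLT hT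
  have hcau : Cauchy (map z (𝓝[<] T)) :=
    (cauchy_nhds.mono nhdsWithin_le_nhds).map_of_le hlip.uniformContinuousOn (le_principal_iff.2 hmem)
  obtain ⟨y, -, hy⟩ := hK.isComplete _ hcau
    (le_principal_iff.2 (mem_map.2 (Filter.mem_of_superset hmem hzK)))
  exact ⟨y, hy⟩

theorem isSolutionOn_glue (hF : Continuous F) {T : ℝ} (hT : 0 < T) {z y : ℝ → E}
    (hz : IsSolutionOn F (Ico 0 T) z) (hy : IsSolutionOn F (Ici 0) y)
    (hlim : Tendsto z (𝓝[<] T) (𝓝 (y 0))) :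
    IsSolutionOn F (Ici 0) fun t => if t < T then z t else y (t - T) := by
  set g : ℝ → E := fun t => if t < T then z t else y (t - T) with hg
  have hgz : ∀ t, t < T → g t = z t := fun t ht => if_pos ht
  have hgy : ∀ t, T ≤ t → g t = y (t - T) := fun t ht => if_neg ht.not_gt
  have hright : ∀ t, T ≤ t → HasDerivWithinAt g (F (g t)) (Ici T) t := fun t ht => by
    have h1 := (hy (t - T) (sub_nonneg.2 ht)).scomp t
      (((hasDerivAt_id t).sub_const T).hasDerivWithinAt (s := Ici T))
      fun s hs => mem_Ici.2 (sub_nonneg.2 hs)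
    rw [one_smul, ← hgy t ht] at h1
    exact h1.congr (fun s hs => hgy s hs) (hgy t ht)
  intro t ht
  rcases lt_trichotomy t T with h | rfl | h
  · have h1 : HasDerivWithinAt g (F (g t)) (Ico 0 T) t := by
      rw [hgz t h]
      exact (hz t ⟨ht, h⟩).congr (fun s hs => hgz s hs.2) (hgz t h)
    refine h1.mono_of_mem_nhdsWithin ?_
    rw [← Ici_inter_Iio]
    exact inter_mem self_mem_nhdsWithin (mem_nhdsWithin_of_mem_nhds (Iio_mem_nhds h))
  · -- at the junction the left derivative is the limit of the derivatives
    have hgt : g t = y 0 := by rw [hgy t le_rfl, sub_self]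
    have hder : ∀ s ∈ Ioo 0 t, HasDerivAt g (F (z s)) s := fun s hs =>
      ((hz s ⟨hs.1.le, hs.2⟩).hasDerivAt (Ico_mem_nhds hs.1 hs.2)).congr_of_eventuallyEq
        (eventually_of_mem (Iio_mem_nhds hs.2) hgz)
    have hmem : Ioo 0 t ∈ 𝓝[<] t := Ioo_mem_nhdsLT hT
    have hleft : HasDerivWithinAt g (F (g t)) (Iic t) t := by
      refine hasDerivWithinAt_Iic_of_tendsto_deriv (s := Ioo 0 t)
        (fun s hs => (hder s hs).differentiableAt.differentiableWithinAt) ?_ hmem ?_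
      · rw [ContinuousWithinAt, hgt]
        exact (hlim.mono_left (nhdsWithin_mono _ fun s hs => hs.2)).congr'
          (eventually_of_mem self_mem_nhdsWithin fun s hs => (hgz s hs.2).symm)
      · rw [hgt]
        exact ((hF.tendsto _).comp hlim).congr'
          (eventually_of_mem hmem fun s hs => (hder s hs).deriv.symm)
    exact (hleft.union (hright t le_rfl)).mono fun s _ => le_total s t
  · refine (hright t h.le).mono_of_mem_nhdsWithin (mem_nhdsWithin_of_mem_nhds (Ici_mem_nhds h))

/-- Global existence. The field is cut off outside the sublevel set of the initial value; the
cut-off field is bounded, has the same nonincreasing function `V`, and so its solution never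
leaves the region where nothing was changed. -/
theorem exists_solution_of_nonincreasing [ProperSpace E] (hF : Continuous F)
    (hV : Differentiable ℝ V) (hK : ∀ a, IsCompact {z | V z ≤ a})
    (hdec : ∀ z, fderiv ℝ V z (F z) ≤ 0) (z₀ : E) :
    ∃ z, IsSolutionOn F (Ici 0) z ∧ z 0 = z₀ := by
  let χ : E → ℝ := fun z => max 0 (min 1 (V z₀ + 1 - V z))
  have hχ : Continuous χ :=
    continuous_const.max (continuous_const.min (continuous_const.sub hV.continuous))
  have hχ0 : ∀ z, 0 ≤ χ z := fun z => le_max_left _ _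
  have hχ1 : ∀ z, χ z ≤ 1 := fun z => max_le zero_le_one (min_le_left _ _)
  have hone : ∀ z, V z ≤ V z₀ → χ z = 1 := fun z hz => by
    simp only [χ]
    rw [min_eq_left (by linarith), max_eq_right zero_le_one]
  have hzero : ∀ z, V z₀ + 1 < V z → χ z = 0 := fun z hz => by
    simp only [χ]
    rw [min_eq_right (by linarith), max_eq_left (by linarith)]
  obtain ⟨M, hM⟩ := (hK (V z₀ + 1)).exists_bound_of_continuousOn hF.continuousOn
  have hM0 : 0 ≤ M := (norm_nonneg _).trans (hM z₀ (by simp))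
  have hbd : ∀ z, ‖χ z • F z‖ ≤ M := fun z => by
    rw [norm_smul, Real.norm_of_nonneg (hχ0 z)]
    rcases le_or_gt (V z) (V z₀ + 1) with h | h
    · exact (mul_le_of_le_one_left (norm_nonneg _) (hχ1 z)).trans (hM z h)
    · rwa [hzero z h, zero_mul]
  obtain ⟨z, hz, hz0⟩ := exists_solution_of_bounded (hχ.smul hF) hbd z₀
  have hanti := antitoneOn_comp_solution hV
    (fun z => by
      rw [Pi.smul_apply', map_smul, smul_eq_mul]
      exact mul_nonpos_of_nonneg_of_nonpos (hχ0 z) (hdec z)) (convex_Ici 0) hz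
  refine ⟨z, fun t ht => ?_, hz0⟩
  have h1 : V (z t) ≤ V z₀ := by
    have := hanti self_mem_Ici ht ht
    rwa [Function.comp_apply, Function.comp_apply, hz0] at this
  have h2 := hz t ht
  simpa only [Pi.smul_apply', hone _ h1, one_smul] using h2

theorem exists_extension_of_nonincreasing [ProperSpace E] (hF : Continuous F)
    (hV : Differentiable ℝ V) (hK : ∀ a, IsCompact {z | V z ≤ a})
    (hdec : ∀ z, fderiv ℝ V z (F z) ≤ 0) (T : ℝ) (z : ℝ → E) (hz : IsSolutionOn F (Ico 0 T) z) :
    ∃ z', IsSolutionOn F (Ici 0) z' ∧ EqOn z' z (Ico 0 T) := by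
  rcases le_or_gt T 0 with hT | hT
  · obtain ⟨z', hz', -⟩ := exists_solution_of_nonincreasing hF hV hK hdec (z 0)
    exact ⟨z', hz', by simp [Ico_eq_empty hT.not_gt]⟩
  · have hanti := antitoneOn_comp_solution hV hdec (convex_Ico 0 T) hz
    obtain ⟨L, hL⟩ := exists_tendsto_solution hF (hK (V (z 0))) hT hz
      fun t ht => hanti (left_mem_Ico.2 hT) ht ht.1
    obtain ⟨y, hy, hy0⟩ := exists_solution_of_nonincreasing hF hV hK hdec L
    exact ⟨_, isSolutionOn_glue hF hT hz hy (hy0 ▸ hL), fun t ht => if_pos ht.2⟩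

/-- Away from the zeros of `F`, but inside a compact set, the speed of `z` is bounded above and the
decay rate of `V` is bounded below. A stay of `z` away from the zeros thus costs a fixed amount of
`V`, and only finitely many such stays are possible. -/
theorem tendsto_infEDist_zeros (hF : Continuous F) (hV : Differentiable ℝ V)
    (hK : ∀ a, IsCompact {z | V z ≤ a}) (hc : 0 < c)
    (hdec : ∀ z, fderiv ℝ V z (F z) ≤ -(c * ‖F z‖ ^ 2)) {z : ℝ → E}
    (hz : IsSolutionOn F (Ici 0) z) :
    Tendsto (fun t => Metric.infEDist (z t) {y | F y = 0}) atTop (𝓝 0) := by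
  have hdec0 : ∀ z, fderiv ℝ V z (F z) ≤ 0 := fun z =>
    (hdec z).trans (neg_nonpos.2 (by positivity))
  have hanti := antitoneOn_comp_solution hV hdec0 (convex_Ici 0) hz
  set K := {y | V y ≤ V (z 0)} with hKdef
  have hzK : ∀ t ∈ Ici (0 : ℝ), z t ∈ K := fun t ht => hanti self_mem_Ici ht ht
  obtain ⟨M, hM⟩ := (hK (V (z 0))).exists_bound_of_continuousOn hF.continuousOn
  have hM0 : 0 ≤ M := (norm_nonneg _).trans (hM (z 0) (le_refl (V (z 0))))
  obtain ⟨β, hβ⟩ := ((hK (V (z 0))).image hV.continuous).bddBelow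
  have hβz : ∀ t ∈ Ici (0 : ℝ), β ≤ V (z t) := fun t ht => hβ (mem_image_of_mem V (hzK t ht))
  rw [ENNReal.tendsto_nhds_zero]
  intro ε hε
  obtain ⟨δ, hδ, hδε⟩ : ∃ δ : ℝ, 0 < δ ∧ ENNReal.ofReal δ ≤ ε := by
    obtain ⟨δ, hδ, hδε⟩ := ENNReal.lt_iff_exists_nnreal_btwn.1 hε
    exact ⟨δ, by exact_mod_cast hδ, by rw [ENNReal.ofReal_coe_nnreal]; exact hδε.le⟩
  let S := K ∩ {y | ENNReal.ofReal (δ / 2) ≤ Metric.infEDist y {y | F y = 0}}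
  have hS : IsCompact S := (hK (V (z 0))).inter_right
    (isClosed_le continuous_const Metric.continuous_infEDist)
  obtain ⟨m, hm, hmS⟩ : ∃ m : ℝ, 0 < m ∧ ∀ y ∈ S, m ≤ ‖F y‖ ^ 2 := by
    rcases S.eq_empty_or_nonempty with h | h
    · exact ⟨1, one_pos, by simp [h]⟩
    · obtain ⟨y, hy, hmin⟩ := hS.exists_isMinOn h (hF.norm.pow 2).continuousOn
      refine ⟨‖F y‖ ^ 2, ?_, fun x hx => hmin hx⟩
      have : F y ≠ 0 := fun h0 => by
        have h1 : ENNReal.ofReal (δ / 2) ≤ Metric.infEDist y {y | F y = 0} := hy.2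
        rw [Metric.infEDist_zero_of_mem (s := {y | F y = 0}) h0, nonpos_iff_eq_zero,
          ENNReal.ofReal_eq_zero] at h1
        linarith
      positivity
  set τ := δ / (2 * (M + 1)) with hτdef
  have hτ : 0 < τ := by positivity
  have hMτ : M * τ ≤ δ / 2 := by
    rw [hτdef, mul_div_assoc', div_le_div_iff₀ (by positivity) (by positivity)]
    nlinarith
  -- a late time at which `V` is almost at its infimum along the solution
  have hbdd : BddBelow ((V ∘ z) '' Ici 0) := ⟨β, by rintro _ ⟨t, ht, rfl⟩; exact hβz t ht⟩
  obtain ⟨_, ⟨t₀, ht₀, rfl⟩, hlt⟩ := exists_lt_of_csInf_lt (s := (V ∘ z) '' Ici 0)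
    ⟨_, mem_image_of_mem _ self_mem_Ici⟩ (lt_add_of_pos_right _ (show 0 < c * m * τ by positivity))
  filter_upwards [eventually_ge_atTop t₀] with t ht
  have ht0 : 0 ≤ t := ht₀.out.trans ht
  by_contra! hcon
  have hfar : ∀ s ∈ Icc t (t + τ), z s ∈ S := fun s hs => by
    have hs0 : 0 ≤ s := ht0.trans hs.1
    refine ⟨hzK s hs0, ?_⟩
    have h1 : edist (z t) (z s) ≤ ENNReal.ofReal (δ / 2) := by
      rw [edist_dist, dist_comm, dist_eq_norm]
      refine ENNReal.ofReal_le_ofReal ?_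
      refine (norm_solution_sub_le hM (convex_Ici 0) hz hzK ht0 hs0).trans (le_trans ?_ hMτ)
      rw [abs_of_nonneg (sub_nonneg.2 hs.1)]
      exact mul_le_mul_of_nonneg_left (by linarith [hs.2]) hM0
    have h2 : ENNReal.ofReal (δ / 2) + ENNReal.ofReal (δ / 2) ≤
        Metric.infEDist (z s) {y | F y = 0} + ENNReal.ofReal (δ / 2) := by
      rw [← ENNReal.ofReal_add (by positivity) (by positivity), add_halves]
      exact (hδε.trans hcon.le).trans
        (Metric.infEDist_le_infEDist_add_edist.trans (add_le_add le_rfl h1))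
    exact (ENNReal.add_le_add_iff_right ENNReal.ofReal_ne_top).1 h2
  have hsub : Icc t (t + τ) ⊆ Ici 0 := fun s hs => ht0.trans hs.1
  have hdrop := (convex_Icc t (t + τ)).image_sub_le_mul_sub_of_deriv_le (f := V ∘ z)
    (C := -(c * m))
    (fun s hs => ((hasDerivWithinAt_comp_solution hV hz (hsub hs)).continuousWithinAt).mono hsub)
    (fun s hs => ((hasDerivWithinAt_comp_solution hV hz
      (hsub (interior_subset hs))).differentiableWithinAt).mono (interior_subset.trans hsub))
    (fun s hs => by
      have hs' := interior_subset hs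
      rw [interior_Icc] at hs
      rw [((hasDerivWithinAt_comp_solution hV hz (hsub hs')).hasDerivAt
        (Ici_mem_nhds (ht0.trans_lt hs.1))).deriv]
      refine (hdec _).trans (neg_le_neg ?_)
      exact mul_le_mul_of_nonneg_left (hmS _ (hfar s hs')) hc.le)
    t (left_mem_Icc.2 (by linarith)) (t + τ) (right_mem_Icc.2 (by linarith)) (by linarith)
  have h1 : sInf ((V ∘ z) '' Ici 0) ≤ (V ∘ z) (t + τ) :=
    csInf_le hbdd (mem_image_of_mem _ (mem_Ici.2 (by linarith)))
  have h2 := hanti ht₀ ht0 ht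
  rw [add_sub_cancel_left] at hdrop
  linarith

/-- If `V` decays strictly outside the zeros of `F`, then an asymptotically stable equilibrium is a
strict local minimizer of `V`: the solution from a nearby point `y` tends to the equilibrium, and
`V` cannot stay constant along it, since this would make `y` a second equilibrium. -/
theorem strictLocalMin_of_isAsymptoticallyStable [ProperSpace E] (hF : Continuous F)
    (hV : Differentiable ℝ V) (hK : ∀ a, IsCompact {z | V z ≤ a}) (hc : 0 < c)
    (hdec : ∀ z, fderiv ℝ V z (F z) ≤ -(c * ‖F z‖ ^ 2)) {zs : E}
    (hzs : IsAsymptoticallyStable F zs) : ∀ᶠ y in 𝓝[≠] zs, V zs < V y := by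
  have hdec0 : ∀ z, fderiv ℝ V z (F z) ≤ 0 := fun z =>
    (hdec z).trans (neg_nonpos.2 (by positivity))
  obtain ⟨-, -, d, hd, hattr⟩ := hzs
  filter_upwards [self_mem_nhdsWithin,
    mem_nhdsWithin_of_mem_nhds (Metric.ball_mem_nhds zs hd)] with y hne hyd
  obtain ⟨z, hz, hz0⟩ := exists_solution_of_nonincreasing hF hV hK hdec0 y
  have hlim := (hV.continuous.tendsto zs).comp (hattr z hz (by rwa [hz0]))
  have hanti := antitoneOn_comp_solution hV hdec0 (convex_Ici 0) hz
  have hge : ∀ t ∈ Ici (0 : ℝ), V zs ≤ V (z t) := fun t ht =>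
    le_of_tendsto hlim ((eventually_ge_atTop t).mono fun s hs =>
      hanti ht (ht.out.trans hs) hs)
  refine lt_of_le_of_ne (hz0 ▸ hge 0 self_mem_Ici) fun heq => hne ?_
  have hconst : ∀ t ∈ Ici (0 : ℝ), (V ∘ z) t = V zs := fun t ht =>
    le_antisymm ((hanti self_mem_Ici ht ht).trans_eq
      (by rw [Function.comp_apply, hz0, heq])) (hge t ht)
  have hderiv := (uniqueDiffOn_Ici (0 : ℝ) 0 self_mem_Ici).eq_deriv _
    (hasDerivWithinAt_comp_solution hV hz self_mem_Ici)
    ((hasDerivWithinAt_const (0 : ℝ) (Ici 0) (V zs)).congr hconst (hconst 0 self_mem_Ici))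
  have hFy : F y = 0 := by
    have h1 := hdec (z 0)
    rw [hderiv, hz0] at h1
    by_contra hFy
    have : 0 < c * ‖F y‖ ^ 2 := by positivity
    linarith
  have hyconst : IsSolutionOn F (Ici 0) fun _ => y := fun t _ => by
    simpa only [hFy] using hasDerivWithinAt_const t (Ici 0) y
  exact tendsto_nhds_unique tendsto_const_nhds (hattr _ hyconst hyd)

end Lyapunov

/-! ### Matrices acting on Euclidean spaces -/

section MatrixAction

variable {k l m : ℕ}

/-- `act M` as a continuous linear map. -/
noncomputable def actCLM (M : Matrix (Fin k) (Fin m) ℝ) :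
    EuclideanSpace ℝ (Fin m) →L[ℝ] EuclideanSpace ℝ (Fin k) :=
  LinearMap.toContinuousLinearMap (Matrix.toEuclideanLin M)

theorem actCLM_apply (M : Matrix (Fin k) (Fin m) ℝ) (v : EuclideanSpace ℝ (Fin m)) :
    actCLM M v = act M v := rfl

theorem act_add (M : Matrix (Fin k) (Fin m) ℝ) (v v' : EuclideanSpace ℝ (Fin m)) :
    act M (v + v') = act M v + act M v' :=
  map_add (actCLM M) v v'

theorem act_sub (M : Matrix (Fin k) (Fin m) ℝ) (v v' : EuclideanSpace ℝ (Fin m)) :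
    act M (v - v') = act M v - act M v' :=
  map_sub (actCLM M) v v'

theorem act_neg (M : Matrix (Fin k) (Fin m) ℝ) (v : EuclideanSpace ℝ (Fin m)) :
    act M (-v) = -act M v :=
  map_neg (actCLM M) v

theorem act_smul (M : Matrix (Fin k) (Fin m) ℝ) (r : ℝ) (v : EuclideanSpace ℝ (Fin m)) :
    act M (r • v) = r • act M v :=
  map_smul (actCLM M) r v

theorem act_zero (M : Matrix (Fin k) (Fin m) ℝ) : act M 0 = 0 :=
  map_zero (actCLM M)

theorem act_act (M : Matrix (Fin k) (Fin l) ℝ) (N : Matrix (Fin l) (Fin m) ℝ)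
    (v : EuclideanSpace ℝ (Fin m)) : act M (act N v) = act (M * N) v := by
  simp [act, Matrix.mulVec_mulVec]

theorem continuous_act (M : Matrix (Fin k) (Fin m) ℝ) : Continuous (act M) :=
  (actCLM M).continuous

theorem norm_act_le (M : Matrix (Fin k) (Fin m) ℝ) (v : EuclideanSpace ℝ (Fin m)) :
    ‖act M v‖ ≤ ‖M‖ * ‖v‖ :=
  Matrix.l2_opNorm_mulVec M v

theorem inner_act_transpose (M : Matrix (Fin k) (Fin m) ℝ) (v : EuclideanSpace ℝ (Fin k))
    (v' : EuclideanSpace ℝ (Fin m)) : inner ℝ (act Mᵀ v) v' = inner ℝ v (act M v') := by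
  simp only [EuclideanSpace.inner_eq_star_dotProduct, act, star_trivial]
  rw [dotProduct_comm, Matrix.mulVec_transpose, ← Matrix.dotProduct_mulVec, dotProduct_comm]

/-- The factor `r` is the minimum of the quadratic form over the unit sphere. -/
theorem exists_mul_sq_norm_le_inner_act {P : Matrix (Fin k) (Fin k) ℝ} (hP : P.PosDef) :
    ∃ r > 0, ∀ v, r * ‖v‖ ^ 2 ≤ inner ℝ v (act P v) := by
  have hpos : ∀ v : EuclideanSpace ℝ (Fin k), v ≠ 0 → 0 < inner ℝ v (act P v) := fun v hv => by
    have := hP.dotProduct_mulVec_pos (x := v.ofLp) (by simpa using hv)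
    rwa [EuclideanSpace.inner_eq_star_dotProduct, dotProduct_comm]
  have hcont : Continuous fun v : EuclideanSpace ℝ (Fin k) => inner ℝ v (act P v) :=
    continuous_id.inner (continuous_act P)
  rcases (Metric.sphere (0 : EuclideanSpace ℝ (Fin k)) 1).eq_empty_or_nonempty with h | h
  · refine ⟨1, one_pos, fun v => ?_⟩
    by_cases hv : v = 0
    · simp [hv]
    · have : (‖v‖⁻¹ • v) ∈ Metric.sphere (0 : EuclideanSpace ℝ (Fin k)) 1 := by
        simp [norm_smul, hv]
      simp [h] at this
  · obtain ⟨v₀, hv₀, hmin⟩ := (isCompact_sphere 0 1).exists_isMinOn h hcont.continuousOn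
    refine ⟨inner ℝ v₀ (act P v₀), hpos v₀ fun h0 => by simp [h0] at hv₀, fun v => ?_⟩
    by_cases hv : v = 0
    · simp [hv]
    · have hmem : (‖v‖⁻¹ • v) ∈ Metric.sphere (0 : EuclideanSpace ℝ (Fin k)) 1 := by
        simp [norm_smul, hv]
      have h1 : inner ℝ v₀ (act P v₀) ≤ inner ℝ (‖v‖⁻¹ • v) (act P (‖v‖⁻¹ • v)) := hmin hmem
      rw [act_smul, real_inner_smul_left, real_inner_smul_right] at h1
      have hv' := norm_pos_iff.2 hv
      calc inner ℝ v₀ (act P v₀) * ‖v‖ ^ 2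
          ≤ (‖v‖⁻¹ * (‖v‖⁻¹ * inner ℝ v (act P v))) * ‖v‖ ^ 2 := by gcongr
        _ = inner ℝ v (act P v) := by field_simp

/-- The Lyapunov inequality `AᵀP + PA ⪯ -I` as a bound on the derivative of `v ↦ ⟪P v, v⟫`. -/
theorem two_mul_inner_act_le {A P : Matrix (Fin k) (Fin k) ℝ} (hP : Pᵀ = P)
    (hLyap : (-1 - (Aᵀ * P + P * A)).PosSemidef) (v : EuclideanSpace ℝ (Fin k)) :
    2 * inner ℝ (act P v) (act A v) ≤ -‖v‖ ^ 2 := by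
  have h1 := hLyap.dotProduct_mulVec_nonneg v.ofLp
  have h2 : star v.ofLp ⬝ᵥ ((-1 - (Aᵀ * P + P * A)) *ᵥ v.ofLp)
      = inner ℝ v (act (-1 - (Aᵀ * P + P * A)) v) := by
    rw [EuclideanSpace.inner_eq_star_dotProduct, dotProduct_comm]
    rfl
  have h3 : act (-1 - (Aᵀ * P + P * A)) v = -v - (act Aᵀ (act P v) + act P (act A v)) := by
    rw [act_act, act_act]
    simp [act, Matrix.sub_mulVec, Matrix.add_mulVec, Matrix.neg_mulVec]
  have h4 : inner ℝ v (act Aᵀ (act P v)) = inner ℝ (act P v) (act A v) := by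
    rw [real_inner_comm, inner_act_transpose]
  have h5 : inner ℝ v (act P (act A v)) = inner ℝ (act P v) (act A v) := by
    rw [← inner_act_transpose, hP]
  rw [h2, h3, inner_sub_right, inner_add_right, inner_neg_right, h4, h5,
    real_inner_self_eq_norm_sq] at h1
  linarith

theorem isUnit_of_lyapunov {A P : Matrix (Fin k) (Fin k) ℝ} (hP : Pᵀ = P)
    (hLyap : (-1 - (Aᵀ * P + P * A)).PosSemidef) : IsUnit A := by
  rw [← Matrix.mulVec_injective_iff_isUnit]
  refine (injective_iff_map_eq_zero A.mulVecLin).2 fun v hv => ?_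
  have h1 := two_mul_inner_act_le hP hLyap (WithLp.toLp 2 v)
  have h2 : act A (WithLp.toLp 2 v) = 0 := by
    rw [act, show A *ᵥ v = 0 from hv]
    rfl
  rw [h2, inner_zero_right, mul_zero] at h1
  have h3 : ‖WithLp.toLp 2 v‖ = 0 := by nlinarith [norm_nonneg (WithLp.toLp 2 v)]
  simpa using h3

end MatrixAction

/-! ### The energy of the closed loop -/

section ClosedLoop

variable {n p q : ℕ} {A : Matrix (Fin n) (Fin n) ℝ} {B : Matrix (Fin n) (Fin p) ℝ}
  {Q : Matrix (Fin n) (Fin q) ℝ} {w : EuclideanSpace ℝ (Fin q)}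
  {Φ : EuclideanSpace ℝ (Fin n) × EuclideanSpace ℝ (Fin p) → ℝ} {ε : ℝ}

theorem act_gain {m : ℕ} (hA : IsUnit A) (M : Matrix (Fin n) (Fin m) ℝ)
    (v : EuclideanSpace ℝ (Fin m)) : act A (act (gain A M) v) = -act M v := by
  rw [act_act, gain, Matrix.mul_neg,
    Matrix.mul_nonsing_inv_cancel_left _ _ ((Matrix.isUnit_iff_isUnit_det A).1 hA)]
  simp [act, Matrix.neg_mulVec]

/-- The deviation `x - (H u + R w)` of the state from the steady state of the current input. -/
noncomputable def deviation (A : Matrix (Fin n) (Fin n) ℝ) (B : Matrix (Fin n) (Fin p) ℝ)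
    (Q : Matrix (Fin n) (Fin q) ℝ) (w : EuclideanSpace ℝ (Fin q))
    (z : EuclideanSpace ℝ (Fin n) × EuclideanSpace ℝ (Fin p)) : EuclideanSpace ℝ (Fin n) :=
  z.1 - steadyState A B Q w z.2

theorem act_deviation (hA : IsUnit A)
    (z : EuclideanSpace ℝ (Fin n) × EuclideanSpace ℝ (Fin p)) :
    act A (deviation A B Q w z) = act A z.1 + act B z.2 + act Q w := by
  rw [deviation, steadyState, act_sub, act_add, act_gain hA, act_gain hA]
  abel

theorem continuous_steadyState : Continuous (steadyState A B Q w) :=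
  (continuous_act _).add continuous_const

theorem hasFDerivAt_steadyState (u : EuclideanSpace ℝ (Fin p)) :
    HasFDerivAt (steadyState A B Q w) (actCLM (gain A B)) u :=
  (actCLM (gain A B)).hasFDerivAt.add_const _

theorem continuous_closedLoop (hcont : Continuous (feedbackGrad A B Φ)) :
    Continuous (closedLoop A B Q w ε Φ) :=
  ((((continuous_act A).comp continuous_fst).add ((continuous_act B).comp continuous_snd)).add
    continuous_const).prodMk (hcont.const_smul ε).neg

theorem zeros_closedLoop (hA : IsUnit A) (hε : 0 < ε) :
    {z | closedLoop A B Q w ε Φ z = 0} = criticalSet A B Q w Φ := by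
  ext z
  have h1 : act A z.1 + act B z.2 + act Q w = 0 ↔ z ∈ feasibleSet A B Q w := by
    have hinj : act A (deviation A B Q w z) = 0 ↔ deviation A B Q w z = 0 := by
      refine ⟨fun h => ?_, fun h => by rw [h, act_zero]⟩
      have h' : A *ᵥ (deviation A B Q w z).ofLp = A *ᵥ 0 := by
        rw [Matrix.mulVec_zero]
        exact congrArg WithLp.ofLp h
      exact WithLp.ofLp_injective 2 (Matrix.mulVec_injective_iff_isUnit.2 hA h')
    rw [← act_deviation hA, hinj, deviation, sub_eq_zero]
    rfl
  have h2 : feedbackGrad A B Φ z = 0 ↔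
      ∃ v : EuclideanSpace ℝ (Fin n), gradX Φ z = v ∧ gradU Φ z = -act (gain A B)ᵀ v := by
    rw [exists_eq_left', feedbackGrad, add_comm, add_eq_zero_iff_eq_neg]
  simp only [mem_ofPred_eq, closedLoop, criticalSet, Prod.mk_eq_zero, neg_eq_zero, smul_eq_zero,
    hε.ne', false_or, h1, h2]

theorem fderiv_eq_inner_grad (hdiff : Differentiable ℝ Φ)
    (z v : EuclideanSpace ℝ (Fin n) × EuclideanSpace ℝ (Fin p)) :
    fderiv ℝ Φ z v = inner ℝ (gradX Φ z) v.1 + inner ℝ (gradU Φ z) v.2 := by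
  have h1 : fderiv ℝ (fun x => Φ (x, z.2)) z.1 = (fderiv ℝ Φ z).comp (.inl ℝ _ _) :=
    ((hdiff (z.1, z.2)).hasFDerivAt.comp z.1 (hasFDerivAt_prodMk_left z.1 z.2)).fderiv
  have h2 : fderiv ℝ (fun u => Φ (z.1, u)) z.2 = (fderiv ℝ Φ z).comp (.inr ℝ _ _) :=
    ((hdiff (z.1, z.2)).hasFDerivAt.comp z.2 (hasFDerivAt_prodMk_right z.1 z.2)).fderiv
  rw [gradX, gradU, inner_gradient_left, inner_gradient_left, h1, h2,
    ContinuousLinearMap.comp_apply, ContinuousLinearMap.comp_apply, ← map_add]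
  simp

theorem hasFDerivAt_reducedCost (hdiff : Differentiable ℝ Φ) (u : EuclideanSpace ℝ (Fin p)) :
    HasFDerivAt (reducedCost A B Q w Φ) (innerSL ℝ (feedbackGrad A B Φ (steadyState A B Q w u, u)))
      u := by
  have h := HasFDerivAt.comp (g := Φ) (f := fun u => (steadyState A B Q w u, u)) u
    (hdiff (steadyState A B Q w u, u)).hasFDerivAt
    ((hasFDerivAt_steadyState u).prodMk (hasFDerivAt_id u))
  refine h.congr_fderiv ?_
  ext v
  rw [ContinuousLinearMap.comp_apply, fderiv_eq_inner_grad hdiff, innerSL_apply_apply, feedbackGrad,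
    inner_add_left, inner_act_transpose]
  rfl

/-- The Lyapunov function: a combination of the reduced cost at the current input and of the
energy `⟪y, P y⟫` of the deviation `y` from the steady state. -/
noncomputable def energy (A : Matrix (Fin n) (Fin n) ℝ) (B : Matrix (Fin n) (Fin p) ℝ)
    (Q : Matrix (Fin n) (Fin q) ℝ) (w : EuclideanSpace ℝ (Fin q)) (P : Matrix (Fin n) (Fin n) ℝ)
    (Φ : EuclideanSpace ℝ (Fin n) × EuclideanSpace ℝ (Fin p) → ℝ) (a b : ℝ)
    (z : EuclideanSpace ℝ (Fin n) × EuclideanSpace ℝ (Fin p)) : ℝ :=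
  a * reducedCost A B Q w Φ z.2 +
    b * inner ℝ (deviation A B Q w z) (act P (deviation A B Q w z))

variable {P : Matrix (Fin n) (Fin n) ℝ} {a b : ℝ}

theorem hasFDerivAt_energy (hdiff : Differentiable ℝ Φ) (hP : Pᵀ = P)
    (z : EuclideanSpace ℝ (Fin n) × EuclideanSpace ℝ (Fin p)) :
    ∃ D : EuclideanSpace ℝ (Fin n) × EuclideanSpace ℝ (Fin p) →L[ℝ] ℝ,
      HasFDerivAt (energy A B Q w P Φ a b) D z ∧ ∀ v, D v =
      a * inner ℝ (feedbackGrad A B Φ (steadyState A B Q w z.2, z.2)) v.2 +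
      b * (2 * inner ℝ (act P (deviation A B Q w z)) (v.1 - act (gain A B) v.2)) := by
  have hsnd := (ContinuousLinearMap.snd ℝ (EuclideanSpace ℝ (Fin n))
    (EuclideanSpace ℝ (Fin p))).hasFDerivAt (x := z)
  have h1 := (hasFDerivAt_reducedCost (A := A) (B := B) (Q := Q) (w := w) hdiff z.2).comp z hsnd
  have h2 : HasFDerivAt (deviation A B Q w) _ z :=
    hasFDerivAt_fst.sub ((hasFDerivAt_steadyState z.2).comp z hsnd)
  have h3 := (actCLM P).hasFDerivAt.comp z h2
  refine ⟨_, (h1.const_mul a).add ((h2.inner ℝ h3).const_mul b), fun v => ?_⟩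
  have h4 : ∀ y y' : EuclideanSpace ℝ (Fin n), inner ℝ y (act P y') = inner ℝ (act P y) y' :=
    fun y y' => by rw [← inner_act_transpose, hP]
  simp only [add_apply, smul_apply, smul_eq_mul,
    ContinuousLinearMap.comp_apply, innerSL_apply_apply, fderivInnerCLM_apply,
    ContinuousLinearMap.prod_apply, actCLM_apply, sub_apply,
    ContinuousLinearMap.coe_fst', ContinuousLinearMap.coe_snd', Function.comp_apply]
  rw [h4, real_inner_comm (act P (deviation A B Q w z)) (v.1 - _)]
  ring

theorem differentiable_energy (hdiff : Differentiable ℝ Φ) (hP : Pᵀ = P) :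
    Differentiable ℝ (energy A B Q w P Φ a b) := fun z =>
  let ⟨_, hD, _⟩ := hasFDerivAt_energy hdiff hP z
  hD.differentiableAt

/-- Along the closed loop, the deviation `y` obeys `ẏ = A y + ε H g`, where `g` is the feedback
gradient. The two cross terms of the derivative are bounded by the Lipschitz constant of the
feedback gradient and by `‖P H‖`. -/
theorem fderiv_energy_closedLoop_le (hdiff : Differentiable ℝ Φ) (hP : Pᵀ = P)
    (hLyap : (-1 - (Aᵀ * P + P * A)).PosSemidef) {ℓ : ℝ}
    (hlip : ∀ (x x' : EuclideanSpace ℝ (Fin n)) (u : EuclideanSpace ℝ (Fin p)),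
      ‖feedbackGrad A B Φ (x, u) - feedbackGrad A B Φ (x', u)‖ ≤ ℓ * ‖x - x'‖)
    (hε : 0 ≤ ε) (ha : 0 ≤ a) (hb : 0 ≤ b)
    (z : EuclideanSpace ℝ (Fin n) × EuclideanSpace ℝ (Fin p)) :
    fderiv ℝ (energy A B Q w P Φ a b) z (closedLoop A B Q w ε Φ z) ≤
      -(a * ε * ‖feedbackGrad A B Φ z‖ ^ 2
        - ε * (a * ℓ + 2 * b * ‖P * gain A B‖) * ‖feedbackGrad A B Φ z‖ * ‖deviation A B Q w z‖
        + b * ‖deviation A B Q w z‖ ^ 2) := by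
  obtain ⟨D, hD, hDv⟩ := hasFDerivAt_energy (A := A) (B := B) (Q := Q) (w := w) (a := a) (b := b)
    hdiff hP z
  rw [hD.fderiv, hDv]
  have hA := isUnit_of_lyapunov hP hLyap
  set y := deviation A B Q w z with hy
  set g := feedbackGrad A B Φ z with hg
  set g₀ := feedbackGrad A B Φ (steadyState A B Q w z.2, z.2)
  have e1 : inner ℝ g₀ (closedLoop A B Q w ε Φ z).2 = -(ε * inner ℝ g₀ g) := by
    rw [closedLoop, inner_neg_right, real_inner_smul_right]
  have e2 : (closedLoop A B Q w ε Φ z).1 - act (gain A B) (closedLoop A B Q w ε Φ z).2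
      = act A y + ε • act (gain A B) g := by
    rw [hy, act_deviation hA, closedLoop, act_neg, act_smul, sub_neg_eq_add]
  have e3 : ‖g‖ ^ 2 - ℓ * ‖y‖ * ‖g‖ ≤ inner ℝ g₀ g := by
    have h1 : inner ℝ (g - g₀) g ≤ ℓ * ‖y‖ * ‖g‖ :=
      (real_inner_le_norm _ _).trans
        (mul_le_mul_of_nonneg_right (hlip z.1 (steadyState A B Q w z.2) z.2) (norm_nonneg _))
    rw [inner_sub_left, real_inner_self_eq_norm_sq] at h1
    linarith
  have e4 : inner ℝ (act P y) (act (gain A B) g) ≤ ‖P * gain A B‖ * ‖g‖ * ‖y‖ := by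
    nth_rewrite 1 [← hP]
    rw [inner_act_transpose, act_act]
    refine (real_inner_le_norm _ _).trans ?_
    rw [mul_comm]
    exact mul_le_mul_of_nonneg_right (norm_act_le _ _) (norm_nonneg _)
  have e5 := two_mul_inner_act_le hP hLyap y
  rw [e1, e2, inner_add_right, real_inner_smul_right]
  have f3 := mul_le_mul_of_nonneg_left e3 (mul_nonneg ha hε)
  have f4 := mul_le_mul_of_nonneg_left e4 (mul_nonneg (mul_nonneg zero_le_two hb) hε)
  have f5 := mul_le_mul_of_nonneg_left e5 hb
  linarith

theorem exists_coercive_of_sq_lt {r s k : ℝ} (hr : 0 < r) (hs : 0 < s) (h : k ^ 2 < 4 * r * s) :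
    ∃ c > 0, ∀ X Y : ℝ, c * (X ^ 2 + Y ^ 2) ≤ r * X ^ 2 - k * X * Y + s * Y ^ 2 := by
  -- the largest `c` with `k ^ 2 ≤ 4 * (r * s - c * (r + s)) ≤ 4 * (r - c) * (s - c)`
  obtain ⟨c, hc⟩ : ∃ c, c = (4 * r * s - k ^ 2) / (4 * (r + s)) := ⟨_, rfl⟩
  have hc' : c * (4 * (r + s)) = 4 * r * s - k ^ 2 := by rw [hc]; field_simp
  have hc0 : 0 < c := by rw [hc]; exact div_pos (by linarith) (by linarith)
  have hcr : 0 < r - c := by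
    by_contra hcon
    nlinarith [sq_nonneg k, mul_pos hr hr]
  refine ⟨c, hc0, fun X Y => ?_⟩
  have h1 : 0 ≤ 4 * (r - c) * (r * X ^ 2 - k * X * Y + s * Y ^ 2 - c * (X ^ 2 + Y ^ 2)) := by
    have : 4 * (r - c) * (r * X ^ 2 - k * X * Y + s * Y ^ 2 - c * (X ^ 2 + Y ^ 2))
        = (2 * (r - c) * X - k * Y) ^ 2 + 4 * c ^ 2 * Y ^ 2
          + (4 * r * s - k ^ 2 - c * (4 * (r + s))) * Y ^ 2 := by ring
    rw [this, hc', sub_self, zero_mul, add_zero]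
    positivity
  linarith [nonneg_of_mul_nonneg_right h1 (by positivity)]

/-- If `ε (a ℓ + 2 b ‖P H‖)² < 4 a b`, then the energy decays at a rate that dominates the squared
speed. -/
theorem exists_fderiv_energy_le (hdiff : Differentiable ℝ Φ) (hP : Pᵀ = P)
    (hLyap : (-1 - (Aᵀ * P + P * A)).PosSemidef) {ℓ : ℝ}
    (hlip : ∀ (x x' : EuclideanSpace ℝ (Fin n)) (u : EuclideanSpace ℝ (Fin p)),
      ‖feedbackGrad A B Φ (x, u) - feedbackGrad A B Φ (x', u)‖ ≤ ℓ * ‖x - x'‖)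
    (hε : 0 < ε) (ha : 0 < a) (hb : 0 < b)
    (hab : ε * (a * ℓ + 2 * b * ‖P * gain A B‖) ^ 2 < 4 * a * b) :
    ∃ c > 0, ∀ z, fderiv ℝ (energy A B Q w P Φ a b) z (closedLoop A B Q w ε Φ z) ≤
      -(c * ‖closedLoop A B Q w ε Φ z‖ ^ 2) := by
  obtain ⟨c, hc, hcXY⟩ := exists_coercive_of_sq_lt (r := a * ε) (s := b)
    (k := ε * (a * ℓ + 2 * b * ‖P * gain A B‖)) (by positivity) hb
    (by have := mul_lt_mul_of_pos_left hab hε; nlinarith)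
  refine ⟨c / (‖A‖ ^ 2 + ε ^ 2), by positivity, fun z => ?_⟩
  refine (fderiv_energy_closedLoop_le hdiff hP hLyap hlip hε.le ha.le hb.le z).trans
    (neg_le_neg (le_trans ?_ (hcXY _ _)))
  set y := deviation A B Q w z with hy
  set g := feedbackGrad A B Φ z with hg
  have h1 : ‖act A y‖ ^ 2 ≤ ‖A‖ ^ 2 * ‖y‖ ^ 2 := by
    rw [← mul_pow]
    exact pow_le_pow_left₀ (norm_nonneg _) (norm_act_le A y) 2
  have h2 : ‖closedLoop A B Q w ε Φ z‖ ^ 2 ≤ (‖A‖ ^ 2 + ε ^ 2) * (‖g‖ ^ 2 + ‖y‖ ^ 2) := by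
    have h3 : ‖closedLoop A B Q w ε Φ z‖ = max ‖act A y‖ (ε * ‖g‖) := by
      rw [hy, act_deviation (isUnit_of_lyapunov hP hLyap), closedLoop, Prod.norm_mk, norm_neg,
        norm_smul, Real.norm_of_nonneg hε.le]
    have h4 : 0 ≤ ‖A‖ ^ 2 * ‖g‖ ^ 2 := by positivity
    have h5 : 0 ≤ ε ^ 2 * ‖y‖ ^ 2 := by positivity
    have h6 : 0 ≤ ε ^ 2 * ‖g‖ ^ 2 := by positivity
    have h7 : 0 ≤ ‖A‖ ^ 2 * ‖y‖ ^ 2 := by positivity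
    rw [h3]
    rcases max_choice ‖act A y‖ (ε * ‖g‖) with h | h <;> rw [h] <;> nlinarith
  calc c / (‖A‖ ^ 2 + ε ^ 2) * ‖closedLoop A B Q w ε Φ z‖ ^ 2
      ≤ c / (‖A‖ ^ 2 + ε ^ 2) * ((‖A‖ ^ 2 + ε ^ 2) * (‖g‖ ^ 2 + ‖y‖ ^ 2)) := by gcongr
    _ = c * (‖g‖ ^ 2 + ‖y‖ ^ 2) := by field_simp

theorem isCompact_sublevel_energy (hdiff : Differentiable ℝ Φ) (hP : P.PosDef)
    (hcompact : ∀ c : ℝ, IsCompact {u | reducedCost A B Q w Φ u ≤ c}) (ha : 0 < a) (hb : 0 < b)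
    (c : ℝ) : IsCompact {z | energy A B Q w P Φ a b z ≤ c} := by
  have hPt : Pᵀ = P := by simpa using hP.isHermitian.eq
  have hcontφ : Continuous (reducedCost A B Q w Φ) :=
    continuous_iff_continuousAt.2 fun u => (hasFDerivAt_reducedCost hdiff u).continuousAt
  obtain ⟨m, hm⟩ : ∃ m, ∀ u, m ≤ reducedCost A B Q w Φ u := by
    obtain ⟨u₀, -, hmin⟩ := (hcompact (reducedCost A B Q w Φ 0)).exists_isMinOn
      ⟨0, le_refl (reducedCost A B Q w Φ 0)⟩ hcontφ.continuousOn
    refine ⟨reducedCost A B Q w Φ u₀, fun u => ?_⟩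
    rcases le_total (reducedCost A B Q w Φ u) (reducedCost A B Q w Φ 0) with h | h
    · exact hmin h
    · exact (hmin (le_refl (reducedCost A B Q w Φ 0))).trans h
  obtain ⟨r, hr, hrP⟩ := exists_mul_sq_norm_le_inner_act hP
  let K := Metric.closedBall (0 : EuclideanSpace ℝ (Fin n)) √((c - a * m) / (b * r)) ×ˢ
    {u | reducedCost A B Q w Φ u ≤ c / a}
  have hK : IsCompact K := (isCompact_closedBall _ _).prod (hcompact _)
  have himg := hK.image
    (f := fun yu : EuclideanSpace ℝ (Fin n) × EuclideanSpace ℝ (Fin p) =>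
      (yu.1 + steadyState A B Q w yu.2, yu.2))
    ((continuous_fst.add (continuous_steadyState.comp continuous_snd)).prodMk continuous_snd)
  refine himg.of_isClosed_subset
    (isClosed_le (differentiable_energy hdiff hPt).continuous continuous_const) fun z hz => ?_
  have hz' : a * reducedCost A B Q w Φ z.2 +
    b * inner ℝ (deviation A B Q w z) (act P (deviation A B Q w z)) ≤ c := hz
  have h1 := mul_le_mul_of_nonneg_left (hrP (deviation A B Q w z)) hb.le
  have h2 := mul_le_mul_of_nonneg_left (hm z.2) ha.le
  have h3 : 0 ≤ b * (r * ‖deviation A B Q w z‖ ^ 2) := by positivity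
  refine ⟨(deviation A B Q w z, z.2), ⟨?_, ?_⟩, ?_⟩
  · rw [mem_closedBall_zero_iff]
    refine Real.le_sqrt_of_sq_le ?_
    rw [le_div_iff₀ (by positivity)]
    linarith
  · change reducedCost A B Q w Φ z.2 ≤ c / a
    rw [le_div_iff₀ ha]
    linarith
  · exact Prod.ext (sub_add_cancel _ _) rfl

theorem energy_of_mem_feasibleSet
    {z : EuclideanSpace ℝ (Fin n) × EuclideanSpace ℝ (Fin p)} (hz : z ∈ feasibleSet A B Q w) :
    energy A B Q w P Φ a b z = a * Φ z := by
  have h1 : z.1 = steadyState A B Q w z.2 := hz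
  have h2 : deviation A B Q w z = 0 := sub_eq_zero.2 h1
  rw [energy, h2, inner_zero_left, mul_zero, add_zero, reducedCost, ← h1]

/-- Weights for the energy. With `h = ‖P H‖`, the quotient `4 a b / (a ℓ + 2 b h)²` has the maximum
`1 / (2 ℓ h)`, attained for `a ℓ = 2 b h`; for `h = 0` it is unbounded. -/
theorem exists_weights {ℓ h : ℝ} (hℓ : 0 < ℓ) (hh : 0 ≤ h) (hε : 0 < ε)
    (hbound : h ≠ 0 → ε < 1 / (2 * ℓ * h)) :
    ∃ a b : ℝ, 0 < a ∧ 0 < b ∧ ε * (a * ℓ + 2 * b * h) ^ 2 < 4 * a * b := by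
  rcases hh.eq_or_lt with rfl | hh
  · exact ⟨1, ε * ℓ ^ 2, one_pos, by positivity, by nlinarith [mul_pos hε (pow_pos hℓ 2)]⟩
  · refine ⟨2 * h, ℓ, by positivity, hℓ, ?_⟩
    have h1 := hbound hh.ne'
    rw [lt_div_iff₀ (by positivity)] at h1
    have h2 := mul_lt_mul_of_pos_left h1 (show 0 < 8 * ℓ * h by positivity)
    linarith

end ClosedLoop

/-! ### Stability and optimality of the closed loop -/

theorem theorem1 {n p q : ℕ}
    (A : Matrix (Fin n) (Fin n) ℝ) (B : Matrix (Fin n) (Fin p) ℝ) (Q : Matrix (Fin n) (Fin q) ℝ)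
    (w : EuclideanSpace ℝ (Fin q))
    -- the Lyapunov matrix of the plant
    (P : Matrix (Fin n) (Fin n) ℝ) (hP : P.PosDef)
    (hLyap : (-1 - (Aᵀ * P + P * A)).PosSemidef)
    -- the cost
    (Φ : EuclideanSpace ℝ (Fin n) × EuclideanSpace ℝ (Fin p) → ℝ)
    (hdiff : Differentiable ℝ Φ)
    (hcont : Continuous (feedbackGrad A B Φ))
    (hcompact : ∀ c : ℝ, IsCompact {u | reducedCost A B Q w Φ u ≤ c})
    (ℓ : ℝ) (hℓ : 0 < ℓ)
    (hlip : ∀ (x x' : EuclideanSpace ℝ (Fin n)) (u : EuclideanSpace ℝ (Fin p)),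
      ‖feedbackGrad A B Φ (x, u) - feedbackGrad A B Φ (x', u)‖ ≤ ℓ * ‖x - x'‖)
    -- the gain; the bound on it is `+∞` if `P H = 0`
    (ε : ℝ) (hε : 0 < ε)
    (hbound : ‖P * gain A B‖ ≠ 0 → ε < 1 / (2 * ℓ * ‖P * gain A B‖)) :
    -- every initial value has a solution for all times
    (∀ z₀, ∃ z, IsSolutionOn (closedLoop A B Q w ε Φ) (Ici 0) z ∧ z 0 = z₀) ∧
    -- every solution extends to all times
    (∀ (T : ℝ) (z : ℝ → EuclideanSpace ℝ (Fin n) × EuclideanSpace ℝ (Fin p)),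
      IsSolutionOn (closedLoop A B Q w ε Φ) (Ico 0 T) z →
      ∃ z', IsSolutionOn (closedLoop A B Q w ε Φ) (Ici 0) z' ∧ EqOn z' z (Ico 0 T)) ∧
    -- every solution converges to the set of critical points
    (∀ z, IsSolutionOn (closedLoop A B Q w ε Φ) (Ici 0) z →
      Tendsto (fun t => Metric.infEDist (z t) (criticalSet A B Q w Φ)) atTop (𝓝 0)) ∧
    -- only strict local minimizers can be asymptotically stable equilibria
    (∀ zs, IsAsymptoticallyStable (closedLoop A B Q w ε Φ) zs →
      IsStrictLocalMinimizerOn Φ (feasibleSet A B Q w) zs) := by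
  have hPt : Pᵀ = P := by simpa using hP.isHermitian.eq
  have hA := isUnit_of_lyapunov hPt hLyap
  obtain ⟨a, b, ha, hb, hab⟩ := exists_weights hℓ (norm_nonneg (P * gain A B)) hε hbound
  obtain ⟨c, hc, hdec⟩ := exists_fderiv_energy_le (Q := Q) (w := w) hdiff hPt hLyap hlip hε ha hb hab
  have hdec0 : ∀ z, fderiv ℝ (energy A B Q w P Φ a b) z (closedLoop A B Q w ε Φ z) ≤ 0 :=
    fun z => (hdec z).trans (neg_nonpos.2 (by positivity))
  have hF : Continuous (closedLoop A B Q w ε Φ) := continuous_closedLoop hcont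
  have hV : Differentiable ℝ (energy A B Q w P Φ a b) := differentiable_energy hdiff hPt
  have hK := isCompact_sublevel_energy hdiff hP hcompact ha hb
  refine ⟨exists_solution_of_nonincreasing hF hV hK hdec0,
    exists_extension_of_nonincreasing hF hV hK hdec0, fun z hz => ?_, fun zs hzs => ?_⟩
  · rw [← zeros_closedLoop hA hε]
    exact tendsto_infEDist_zeros hF hV hK hc hdec hz
  · have hmem : zs ∈ criticalSet A B Q w Φ := by
      rw [← zeros_closedLoop hA hε]
      exact hzs.1
    refine ⟨hmem.1, ?_⟩
    have hloc := strictLocalMin_of_isAsymptoticallyStable hF hV hK hc hdec hzs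
    filter_upwards [nhdsWithin_mono zs (fun y hy => hy.2) hloc, self_mem_nhdsWithin] with y hy hyS
    rw [energy_of_mem_feasibleSet hmem.1, energy_of_mem_feasibleSet hyS.1] at hy
    exact lt_of_mul_lt_mul_left hy ha.le
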